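/- For a group $G$ and $A \subset G$ write $A^{-1}=\{a^{-1}:a\in A\}$, $A^m = \{x_1\cdots x_m : x_i\in A\}$ (with $A^0=\{e\}$), and $C(g)=\{h\in G: hg=gh\}$; $|S|$ is the number of elements of a finite set $S$. For a field $K$, an element $g\in \mathrm{SL}_2(K)$ is called regular semisimple if it has two distinct eigenvalues in an algebraic closure $\overline{K}$. (1) There are absolute constants $k\in\mathbb{Z}_{\ge 0}$ and $c>0$ such that the following holds. Let $K$ be a field, let $A\subset \mathrm{SL}_2(K)$ be a finite set that generates the group $\mathrm{SL}_2(K)$, let $\ell\geq 1$ be an integer, and let $g\in A^\ell$ be regular semisimple. Then \[ |A^{-1}A\cap C(g)| \;\geq\; c\,\frac{|A|}{|(A\cup A^{-1}\cup\{e\})^{k\ell}|^{2/3}}. \] (2) There is an absolute constant $C>0$ and, for every integer $\ell\geq 1$, a constant $c_\ell>0$ depending only on $\ell$, such that the following holds. Let $K$ be a field, let $A\subset \mathrm{SL}_2(K)$ be a finite set that generates $\mathrm{SL}_2(K)$, let $g\in A^\ell$ be regular semisimple, and let $\delta$ be a real number with $|A^3|\leq |A|^{1+\delta}$. Then \[ |A^{-1}A\cap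 C(g)| \;\geq\; c_\ell\,|A|^{1/3 - C\delta\ell}. \] -/

import Mathlib

open scoped Pointwise

universe u

/-- An element of `SL₂(K)` is regular semisimple if it has two distinct eigenvalues
in an algebraic closure of `K`. -/
def IsRegularSemisimple {K : Type*} [Field K]
    (g : Matrix.SpecialLinearGroup (Fin 2) K) : Prop :=
  ∃ a b : AlgebraicClosure K, a ≠ b ∧
    Module.End.HasEigenvalue
      (Matrix.toLin' ((g : Matrix (Fin 2) (Fin 2) K).map
        (algebraMap K (AlgebraicClosure K)))) a ∧
    Module.End.HasEigenvalue
      (Matrix.toLin' ((g : Matrix (Fin 2) (Fin 2) K).map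
        (algebraMap K (AlgebraicClosure K)))) b

/-!
The map `a ↦ a * g * a⁻¹` on `A` has fibres of size at most `|A⁻¹A ∩ C(g)|`, so it suffices to bound
its image `X`. This is a subset of `S = (A ∪ A⁻¹ ∪ {e}) ^ (ℓ + 2)` whose elements all have the same
trace `t` as `g`, and the claim becomes the dimension estimate `|X| ≪ |S ^ 13| ^ (2 / 3)`
(`card_pow_three_le_of_trace_eq`) for the surface `tr = t` in the three-dimensional group `SL₂`.

The estimate compares two counts of traces. For `h ∈ SL₂(K)` let `m(h)` be the number of values of
`tr (x h)` for `x ∈ X`.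

* There is `b ∈ S ^ 2` such that `[g, b]` is invertible (`exists_det_commutator_ne_zero`). The
  matrices with prescribed `tr x`, `tr (x g)` and `tr (x b)` form a line with direction `[g, b]`,
  which meets `det = 1` at most twice. Hence `|X| ≤ 2 m(g) m(b)` (`card_le_mul_card_image_trace`).
* Take `h ∈ {g, b}` and `y = x h` with `x ∈ X` and `tr y ≠ ± 2`. The centralizer of `y` is spanned
  by `1` and `y`, so two elements `v`, `v'` of trace `t` with the same conjugate of `y` satisfy
  `v' = α v + β v y`, and `tr v' = t`, `det v' = 1` leave at most two choices unless
  `t = tr (v y) = 0`. Therefore the trace class of `y` has `≫ |X|` elements in `S ^ 13`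
  (`card_le_mul_card_trace_fiber`). In the exceptional case the characteristic is not two, and the
  conjugates of `y` by `S ^ 4` span all matrices modulo scalars (`conjSpan_four_eq_top`), so that
  for each `v` one of at most four of them can be used in place of `y`.

Trace classes being disjoint, the second point gives `m(h) |X| ≪ |S ^ 13|` for `h = g, b`, and the
first turns this into `|X| ^ 3 ≪ |S ^ 13| ^ 2`. The second assertion of the theorem follows from the
first one by noncommutative small tripling
(`Finset.card_pow_symmetrization_le_of_small_tripling`).
-/

open scoped Matrix MatrixGroups Finset

/-! ### Intersections of lines with the determinant quadric -/

/-- If `det [a, b] ≠ 0`, a matrix is determined up to two choices by its determinant together with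
the traces of `x`, `x * a` and `x * b`: the three traces are linear and cut out a line with
direction `d = [a, b]`, which is orthogonal to `1`, `a` and `b` for the trace form. Since
`det d ≠ 0`, the determinant restricted to this line is a genuine quadratic polynomial, whose
second root is given explicitly. -/
theorem Matrix.eq_or_eq_of_trace_eq {K : Type*} [Field K] {a b x y : Matrix (Fin 2) (Fin 2) K}
    (hd : (a * b - b * a).det ≠ 0) (hdet : x.det = y.det) (h1 : x.trace = y.trace)
    (ha : (x * a).trace = (y * a).trace) (hb : (x * b).trace = (y * b).trace) :
    y = x ∨ y = x + ((x * (a * b - b * a)).trace / (a * b - b * a).det) • (a * b - b * a) := by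
  obtain ⟨d, hdef⟩ : ∃ d, d = a * b - b * a := ⟨_, rfl⟩
  have e00 : d 0 0 = a 0 1 * b 1 0 - a 1 0 * b 0 1 := by
    rw [hdef]; simp [Matrix.mul_apply, Fin.sum_univ_two]; ring
  have e01 : d 0 1 = (a 0 0 - a 1 1) * b 0 1 - a 0 1 * (b 0 0 - b 1 1) := by
    rw [hdef]; simp [Matrix.mul_apply, Fin.sum_univ_two]; ring
  have e10 : d 1 0 = a 1 0 * (b 0 0 - b 1 1) - (a 0 0 - a 1 1) * b 1 0 := by
    rw [hdef]; simp [Matrix.mul_apply, Fin.sum_univ_two]; ring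
  have e11 : d 1 1 = - d 0 0 := by
    rw [hdef]; simp [Matrix.mul_apply, Fin.sum_univ_two]; ring
  rw [← hdef] at hd ⊢
  simp only [Matrix.det_fin_two, Matrix.trace_fin_two, Matrix.mul_apply, Fin.sum_univ_two]
    at hd hdet h1 ha hb
  -- `y - x` has trace zero, so it is `!![p, q; r, -p]`; both it and `d` are orthogonal to the
  -- traceless parts of `a` and `b`, and hence they are parallel.
  obtain ⟨p, hp⟩ : ∃ p, p = y 0 0 - x 0 0 := ⟨_, rfl⟩
  obtain ⟨q, hq⟩ : ∃ q, q = y 0 1 - x 0 1 := ⟨_, rfl⟩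
  obtain ⟨r, hr⟩ : ∃ r, r = y 1 0 - x 1 0 := ⟨_, rfl⟩
  have ea : p * (a 0 0 - a 1 1) + q * a 1 0 + r * a 0 1 = 0 := by
    rw [hp, hq, hr]; linear_combination (-1) * ha + a 1 1 * h1
  have eb : p * (b 0 0 - b 1 1) + q * b 1 0 + r * b 0 1 = 0 := by
    rw [hp, hq, hr]; linear_combination (-1) * hb + b 1 1 * h1
  have c1 : q * d 0 0 = p * d 0 1 := by
    rw [e00, e01]; linear_combination a 0 1 * eb - b 0 1 * ea
  have c2 : r * d 0 0 = p * d 1 0 := by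
    rw [e00, e10]; linear_combination b 1 0 * ea - a 1 0 * eb
  have c3 : r * d 0 1 = q * d 1 0 := by
    rw [e01, e10]; linear_combination (a 0 0 - a 1 1) * eb - (b 0 0 - b 1 1) * ea
  rw [e11] at hd
  obtain ⟨D, hD⟩ : ∃ D, D = d 0 0 * -d 0 0 - d 0 1 * d 1 0 := ⟨_, rfl⟩
  rw [← hD] at hd
  obtain ⟨l, hl⟩ : ∃ l, l = - (p * d 0 0 + q * d 1 0) / D := ⟨_, rfl⟩
  have hl' : l * D = - (p * d 0 0 + q * d 1 0) := by rw [hl]; field_simp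
  have lp : p = l * d 0 0 := by
    apply mul_right_cancel₀ hd
    linear_combination (- d 0 0) * hl' + p * hD + d 1 0 * c1
  have lq : q = l * d 0 1 := by
    apply mul_right_cancel₀ hd
    linear_combination (- d 0 1) * hl' + q * hD - d 0 0 * c1
  have lr : r = l * d 1 0 := by
    apply mul_right_cancel₀ hd
    linear_combination (- d 1 0) * hl' + r * hD - d 0 0 * c2 - d 1 0 * c3
  have y00 : y 0 0 = x 0 0 + l * d 0 0 := by rw [← lp, hp]; ring
  have y01 : y 0 1 = x 0 1 + l * d 0 1 := by rw [← lq, hq]; ring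
  have y10 : y 1 0 = x 1 0 + l * d 1 0 := by rw [← lr, hr]; ring
  have y11 : y 1 1 = x 1 1 + l * d 1 1 := by
    rw [e11]; linear_combination -y00 - h1
  have htr : (x * d).trace = x 0 0 * d 0 0 + x 0 1 * d 1 0 + (x 1 0 * d 0 1 + x 1 1 * d 1 1) := by
    simp [Matrix.trace_fin_two, Matrix.mul_apply, Fin.sum_univ_two]
  have hdD : d.det = D := by rw [Matrix.det_fin_two, e11, hD]
  have key : l * (l * D - (x * d).trace) = 0 := by
    rw [htr, hD, e11]
    rw [y00, y01, y10, y11, e11] at hdet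
    linear_combination -hdet
  rcases mul_eq_zero.1 key with h | h
  · left
    ext i j; fin_cases i <;> fin_cases j <;> simp [y00, y01, y10, y11, h]
  · right
    have : (x * d).trace / d.det = l := by
      rw [hdD, div_eq_iff hd]; linear_combination -h
    rw [this]
    ext i j; fin_cases i <;> fin_cases j <;> simp [y00, y01, y10, y11]

/-- Let `y` have determinant `1` and trace different from `± 2`. A matrix `w = v * c` with `c` in
the centralizer of `y`, `det c = 1` and `w.trace = v.trace` takes at most two values for given `v`,
provided that `v` and `v * y` are not both traceless. Indeed `c = a • 1 + b • y`, and the trace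
condition is a line in the `(a, b)`-plane, while `det c = 1` is a conic that contains no line as
`y.trace ^ 2 ≠ 4`. -/
theorem Matrix.eq_or_eq_of_commute {K : Type*} [Field K] {v w c y : Matrix (Fin 2) (Fin 2) K}
    (hw : w = v * c) (hdy : y.det = 1) (hdc : c.det = 1) (hcomm : c * y = y * c)
    (hy : y.trace ^ 2 ≠ 4) (ht : w.trace = v.trace) (hne : v.trace ≠ 0 ∨ (v * y).trace ≠ 0) :
    w = v ∨ w = v + ((2 * (v * y).trace - v.trace * y.trace) /
      ((v * y).trace ^ 2 - (v * y).trace * v.trace * y.trace + v.trace ^ 2)) •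
        (v.trace • (v * y) - (v * y).trace • v) := by
  -- The centralizer of a non-scalar `2 × 2` matrix `y` is spanned by `1` and `y`.
  obtain ⟨a, b, hc⟩ : ∃ a b : K, c = a • 1 + b • y := by
    have h00 := congrFun (congrFun hcomm 0) 0
    have h01 := congrFun (congrFun hcomm 0) 1
    have h10 := congrFun (congrFun hcomm 1) 0
    simp only [Matrix.mul_apply, Fin.sum_univ_two] at h00 h01 h10
    by_cases hy1 : y 0 1 = 0
    · by_cases hy2 : y 1 0 = 0
      · have hyd : y 0 0 - y 1 1 ≠ 0 := by
          intro h
          apply hy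
          rw [Matrix.det_fin_two] at hdy
          rw [Matrix.trace_fin_two]
          rw [hy1] at hdy
          linear_combination 4 * hdy + (y 0 0 - y 1 1) * h
        refine ⟨c 0 0 - (c 0 0 - c 1 1) / (y 0 0 - y 1 1) * y 0 0,
          (c 0 0 - c 1 1) / (y 0 0 - y 1 1), ?_⟩
        have z1 : c 0 1 = 0 := by
          rcases mul_eq_zero.1 (show c 0 1 * (y 0 0 - y 1 1) = 0 by
            rw [hy1] at h01; linear_combination -h01) with h | h
          · exact h
          · exact absurd h hyd
        have z2 : c 1 0 = 0 := by
          rcases mul_eq_zero.1 (show c 1 0 * (y 0 0 - y 1 1) = 0 by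
            rw [hy2] at h10; linear_combination h10) with h | h
          · exact h
          · exact absurd h hyd
        ext i j; fin_cases i <;> fin_cases j <;> simp [hy1, hy2, z1, z2]
        field_simp
        ring
      · refine ⟨c 0 0 - c 1 0 / y 1 0 * y 0 0, c 1 0 / y 1 0, ?_⟩
        ext i j; fin_cases i <;> fin_cases j <;> simp <;> field_simp
        · linear_combination h00
        · linear_combination h10
    · refine ⟨c 0 0 - c 0 1 / y 0 1 * y 0 0, c 0 1 / y 0 1, ?_⟩
      ext i j; fin_cases i <;> fin_cases j <;> simp <;> field_simp
      · linear_combination -h00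
      · linear_combination -h01
  have hw' : w = a • v + b • (v * y) := by rw [hw, hc]; simp [mul_add]
  obtain ⟨t, ht'⟩ : ∃ t, t = v.trace := ⟨_, rfl⟩
  obtain ⟨s, hs⟩ : ∃ s, s = (v * y).trace := ⟨_, rfl⟩
  obtain ⟨τ, hτ⟩ : ∃ τ, τ = y.trace := ⟨_, rfl⟩
  have hlin : a * t + b * s = t := by
    have h := congrArg Matrix.trace hw'
    rw [Matrix.trace_add, Matrix.trace_smul, Matrix.trace_smul, ht, ← ht', ← hs] at h
    exact h.symm
  have hquad : a ^ 2 + a * b * τ + b ^ 2 = 1 := by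
    rw [hc] at hdc
    rw [hτ, Matrix.trace_fin_two]
    rw [Matrix.det_fin_two] at hdc hdy
    simp at hdc
    linear_combination hdc - b ^ 2 * hdy
  rw [← ht', ← hs, ← hτ]
  rw [← ht', ← hs] at hne
  rw [← hτ] at hy
  -- Parametrize the line `(1 - a) * t = b * s` through the solution `(1, 0)`.
  obtain ⟨μ, ha, hb⟩ : ∃ μ, a = 1 - μ * s ∧ b = μ * t := by
    by_cases h : t = 0
    · have hs0 : s ≠ 0 := by tauto
      refine ⟨(1 - a) / s, by field_simp; ring, ?_⟩
      rw [h] at hlin ⊢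
      have : b * s = 0 := by linear_combination hlin
      simpa [hs0] using this
    · refine ⟨b / t, ?_, by field_simp⟩
      field_simp
      linear_combination hlin
  obtain ⟨Q, hQ⟩ : ∃ Q, Q = s ^ 2 - s * t * τ + t ^ 2 := ⟨_, rfl⟩
  rw [← hQ]
  have key : μ * (μ * Q - (2 * s - t * τ)) = 0 := by
    rw [hQ]; rw [ha, hb] at hquad; linear_combination hquad
  have hwμ : w = v + μ • (t • (v * y) - s • v) := by
    rw [hw', ha, hb]; module
  rcases mul_eq_zero.1 key with h | h
  · left; rw [hwμ, h]; simp
  · right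
    have hQ0 : Q ≠ 0 := by
      intro h0
      have h2 : 2 * s - t * τ = 0 := by rw [h0] at h; linear_combination -h
      have h3 : t ^ 2 * (τ ^ 2 - 4) = 0 := by
        linear_combination (2 * s - t * τ) * h2 + 4 * hQ - 4 * h0
      have ht0 : t = 0 := by
        rcases mul_eq_zero.1 h3 with h | h
        · exact pow_eq_zero_iff (two_ne_zero) |>.1 h
        · exact absurd (by linear_combination h) hy
      have hs0 : s = 0 := by
        rw [h0, ht0] at hQ
        have : s ^ 2 = 0 := by linear_combination -hQ
        exact pow_eq_zero_iff (two_ne_zero) |>.1 this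
      tauto
    rw [hwμ]
    congr 2
    rw [eq_div_iff hQ0]; linear_combination h

/-! ### Invertible commutators with a regular semisimple element -/

/-- No line over an extension field is preserved by a generating set of `SL(2, K)`, since the two
elementary unipotent matrices have no common eigenvector. -/
theorem exists_mulVec_ne_smul_of_closure_eq_top {K L : Type*} [Field K] [Field L] [Algebra K L]
    {S : Set SL(2, K)} (hS : Subgroup.closure S = ⊤) {v : Fin 2 → L} (hv : v ≠ 0) :
    ∃ s ∈ S, ∀ c : L, ((s : Matrix (Fin 2) (Fin 2) K).map (algebraMap K L)) *ᵥ v ≠ c • v := by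
  by_contra! h
  have hall : ∀ s : SL(2, K), ∃ c : L, c ≠ 0 ∧
      ((s : Matrix (Fin 2) (Fin 2) K).map (algebraMap K L)) *ᵥ v = c • v := by
    intro s
    have hs : s ∈ Subgroup.closure S := by rw [hS]; trivial
    induction hs using Subgroup.closure_induction with
    | mem x hx =>
      obtain ⟨c, hc⟩ := h x hx
      refine ⟨c, ?_, hc⟩
      rintro rfl
      apply hv
      have h1 : ((x⁻¹ : SL(2, K)) : Matrix (Fin 2) (Fin 2) K).map (algebraMap K L) *
          (x : Matrix (Fin 2) (Fin 2) K).map (algebraMap K L) = 1 := by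
        rw [← Matrix.map_mul, ← Matrix.SpecialLinearGroup.coe_mul, inv_mul_cancel]; simp
      rw [← Matrix.one_mulVec v, ← h1, ← Matrix.mulVec_mulVec, hc]; simp
    | one => exact ⟨1, one_ne_zero, by simp⟩
    | mul x y _ _ hx hy =>
      obtain ⟨c, hc0, hc⟩ := hx
      obtain ⟨d, hd0, hd⟩ := hy
      refine ⟨c * d, mul_ne_zero hc0 hd0, ?_⟩
      rw [Matrix.SpecialLinearGroup.coe_mul, Matrix.map_mul, ← Matrix.mulVec_mulVec, hd,
        Matrix.mulVec_smul, hc, smul_smul, mul_comm]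
    | inv x _ hx =>
      obtain ⟨c, hc0, hc⟩ := hx
      refine ⟨c⁻¹, inv_ne_zero hc0, ?_⟩
      have h1 : ((x⁻¹ : SL(2, K)) : Matrix (Fin 2) (Fin 2) K).map (algebraMap K L) *
          (x : Matrix (Fin 2) (Fin 2) K).map (algebraMap K L) = 1 := by
        rw [← Matrix.map_mul, ← Matrix.SpecialLinearGroup.coe_mul, inv_mul_cancel]; simp
      have h2 : v = c⁻¹ • ((x : Matrix (Fin 2) (Fin 2) K).map (algebraMap K L)) *ᵥ v := by
        rw [hc, smul_smul, inv_mul_cancel₀ hc0, one_smul]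
      conv_lhs => rw [h2]
      rw [Matrix.mulVec_smul, Matrix.mulVec_mulVec, h1, Matrix.one_mulVec]
  obtain ⟨c, -, hc⟩ := hall ⟨!![1, 1; 0, 1], by simp [Matrix.det_fin_two]⟩
  obtain ⟨d, -, hd⟩ := hall ⟨!![1, 0; 1, 1], by simp [Matrix.det_fin_two]⟩
  have c0 := congrFun hc 0
  have c1 := congrFun hc 1
  have d0 := congrFun hd 0
  have d1 := congrFun hd 1
  simp [Matrix.mulVec, dotProduct, Fin.sum_univ_two] at c0 c1 d0 d1
  apply hv
  have z1 : v 1 = 0 := by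
    have : v 1 * v 1 = 0 := by linear_combination v 1 * c0 - v 0 * c1
    exact mul_self_eq_zero.1 this
  have z0 : v 0 = 0 := by
    have : v 0 * v 0 = 0 := by linear_combination v 0 * d1 - v 1 * d0
    exact mul_self_eq_zero.1 this
  ext i; fin_cases i <;> simp [z0, z1]

/-- Let `v`, `w` be eigenvectors of `a` for distinct eigenvalues. In the basis `v`, `w` the
commutator `[a, b]` is antidiagonal, and its two entries are nonzero multiples of the off-diagonal
entries of `b`; so if `[a, b]` is singular, `b` preserves one of the two eigenlines. -/
theorem exists_mulVec_eq_smul_of_det_commutator_eq_zero {L : Type*} [Field L]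
    {a b : Matrix (Fin 2) (Fin 2) L}
    {α β : L} {v w : Fin 2 → L} (hαβ : α ≠ β) (hv0 : v ≠ 0) (hw0 : w ≠ 0)
    (hv : a *ᵥ v = α • v) (hw : a *ᵥ w = β • w) (hd : (a * b - b * a).det = 0) :
    (∃ c : L, b *ᵥ v = c • v) ∨ ∃ c : L, b *ᵥ w = c • w := by
  have hli : LinearIndependent L ![v, w] := by
    rw [LinearIndependent.pair_iff]
    intro s t hst
    have h2 : a *ᵥ (s • v + t • w) = 0 := by rw [hst]; simp
    rw [Matrix.mulVec_add, Matrix.mulVec_smul, Matrix.mulVec_smul, hv, hw] at h2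
    have h3 : (s * (α - β)) • v = 0 := by
      have : (s * (α - β)) • v = (s • α • v + t • β • w) - β • (s • v + t • w) := by module
      rw [this, h2, hst]; simp
    have hs : s = 0 := by
      simpa [hv0, sub_ne_zero.2 hαβ] using h3
    subst hs
    refine ⟨rfl, ?_⟩
    simpa [hw0] using hst
  have hspan : ∀ u : Fin 2 → L, ∃ x y : L, u = x • v + y • w := by
    intro u
    have : u ∈ Submodule.span L (Set.range ![v, w]) := by
      rw [hli.span_eq_top_of_card_eq_finrank' (by simp)]; trivial
    simp only [Matrix.range_cons, Matrix.range_empty, Set.union_empty, Set.singleton_union,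
      Submodule.mem_span_pair] at this
    obtain ⟨x, y, h⟩ := this
    exact ⟨x, y, h.symm⟩
  obtain ⟨x, y, hbv⟩ := hspan (b *ᵥ v)
  obtain ⟨z, u, hbw⟩ := hspan (b *ᵥ w)
  have e1 : (a * b - b * a) *ᵥ v = (y * (β - α)) • w := by
    rw [Matrix.sub_mulVec, ← Matrix.mulVec_mulVec, ← Matrix.mulVec_mulVec, hv,
      Matrix.mulVec_smul, hbv, Matrix.mulVec_add, Matrix.mulVec_smul, Matrix.mulVec_smul, hv, hw]
    module
  have e2 : (a * b - b * a) *ᵥ w = (z * (α - β)) • v := by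
    rw [Matrix.sub_mulVec, ← Matrix.mulVec_mulVec, ← Matrix.mulVec_mulVec, hw,
      Matrix.mulVec_smul, hbw, Matrix.mulVec_add, Matrix.mulVec_smul, Matrix.mulVec_smul, hv, hw]
    module
  obtain ⟨n, hn0, hn⟩ := Matrix.exists_mulVec_eq_zero_iff.2 hd
  obtain ⟨p, q, rfl⟩ := hspan n
  rw [Matrix.mulVec_add, Matrix.mulVec_smul, Matrix.mulVec_smul, e1, e2] at hn
  have := LinearIndependent.pair_iff.1 hli (q * (z * (α - β))) (p * (y * (β - α))) (by
    rw [← hn]; module)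
  have hab := sub_ne_zero.2 hαβ
  have hba := sub_ne_zero.2 hαβ.symm
  simp [hab, hba] at this
  by_cases hy : y = 0
  · left; exact ⟨x, by rw [hbv, hy]; simp⟩
  · by_cases hz : z = 0
    · right; exact ⟨u, by rw [hbw, hz]; simp⟩
    · exfalso
      have hp : p = 0 := by tauto
      have hq : q = 0 := by tauto
      simp [hp, hq] at hn0

/-- A regular semisimple `g` has a partner `b` among the products of two generators such that the
commutator `[g, b]` is invertible. If `s` moves the first eigenline of `g` and `s'` the second, then
one of `s`, `s'`, `s * s'` moves both. -/
theorem exists_det_commutator_ne_zero {K : Type*} [Field K] {S : Set SL(2, K)}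
    (hS : Subgroup.closure S = ⊤) (h1 : 1 ∈ S) {g : SL(2, K)} (hg : IsRegularSemisimple g) :
    ∃ b ∈ S * S, ((g : Matrix (Fin 2) (Fin 2) K) * b - b * g).det ≠ 0 := by
  obtain ⟨α, β, hαβ, hα, hβ⟩ := hg
  obtain ⟨v, hv⟩ := hα.exists_hasEigenvector
  obtain ⟨w, hw⟩ := hβ.exists_hasEigenvector
  have hv0 := hv.2
  have hw0 := hw.2
  have hv' := hv.apply_eq_smul
  have hw' := hw.apply_eq_smul
  rw [Matrix.toLin'_apply] at hv' hw'
  by_contra! hall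
  have key : ∀ b ∈ S * S,
      (∃ c : AlgebraicClosure K,
        ((b : Matrix (Fin 2) (Fin 2) K).map (algebraMap K (AlgebraicClosure K))) *ᵥ v = c • v) ∨
      ∃ c : AlgebraicClosure K,
        ((b : Matrix (Fin 2) (Fin 2) K).map (algebraMap K (AlgebraicClosure K))) *ᵥ w = c • w := by
    intro b hb
    refine exists_mulVec_eq_smul_of_det_commutator_eq_zero hαβ hv0 hw0 hv' hw' ?_
    have := congrArg (algebraMap K (AlgebraicClosure K)) (hall b hb)
    rw [RingHom.map_det, RingHom.map_zero] at this
    rw [← Matrix.map_mul, ← Matrix.map_mul, ← Matrix.map_sub _ (map_sub _)]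
    exact this
  obtain ⟨s, hs, hsv⟩ := exists_mulVec_ne_smul_of_closure_eq_top hS hv0
  obtain ⟨s', hs', hsw⟩ := exists_mulVec_ne_smul_of_closure_eq_top hS hw0
  have k1 := (key (s * 1) (Set.mul_mem_mul hs h1)).resolve_left
    (by rw [mul_one]; rintro ⟨c, hc⟩; exact hsv c hc)
  have k2 := (key (s' * 1) (Set.mul_mem_mul hs' h1)).resolve_right
    (by rw [mul_one]; rintro ⟨c, hc⟩; exact hsw c hc)
  rw [mul_one] at k1 k2
  obtain ⟨c, hc⟩ := k1
  obtain ⟨d, hd⟩ := k2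
  have inj : ∀ (x : SL(2, K)) (u : Fin 2 → AlgebraicClosure K),
      ((x : Matrix (Fin 2) (Fin 2) K).map (algebraMap K (AlgebraicClosure K))) *ᵥ u = 0 →
        u = 0 := by
    intro x u hu
    have hdet : ((x : Matrix (Fin 2) (Fin 2) K).map
        (algebraMap K (AlgebraicClosure K))).det ≠ 0 := by
      have := RingHom.map_det (algebraMap K (AlgebraicClosure K)) (x : Matrix (Fin 2) (Fin 2) K)
      rw [RingHom.mapMatrix_apply] at this
      rw [← this]; simp
    exact Matrix.eq_zero_of_mulVec_eq_zero hdet hu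
  have hc0 : c ≠ 0 := by rintro rfl; exact hw0 (inj s w (by rw [hc]; simp))
  have hd0 : d ≠ 0 := by rintro rfl; exact hv0 (inj s' v (by rw [hd]; simp))
  rcases key (s * s') (Set.mul_mem_mul hs hs') with ⟨e, he⟩ | ⟨e, he⟩
  · rw [Matrix.SpecialLinearGroup.coe_mul, Matrix.map_mul, ← Matrix.mulVec_mulVec, hd,
      Matrix.mulVec_smul] at he
    apply hsv (d⁻¹ * e)
    rw [← smul_smul, ← he, smul_smul, inv_mul_cancel₀ hd0, one_smul]
  · rw [Matrix.SpecialLinearGroup.coe_mul, Matrix.map_mul, ← Matrix.mulVec_mulVec] at he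
    apply hsw (c⁻¹ * e)
    have h3 := inj s
      (((s' : Matrix (Fin 2) (Fin 2) K).map (algebraMap K (AlgebraicClosure K))) *ᵥ w
        - (c⁻¹ * e) • w) (by
      rw [Matrix.mulVec_sub, he, Matrix.mulVec_smul, hc, smul_smul, mul_right_comm,
        inv_mul_cancel₀ hc0, one_mul, sub_self])
    exact sub_eq_zero.1 h3

/-! ### Spans of conjugates -/

/-- In characteristic other than two, the only subspace of `2 × 2` matrices that contains the
scalars and a non-scalar matrix and is stable under conjugation by `SL(2, K)` is the whole space. -/
theorem Submodule.eq_top_of_conj_mem {K : Type*} [Field K] (h2 : (2 : K) ≠ 0)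
    {W : Submodule K (Matrix (Fin 2) (Fin 2) K)} {y : Matrix (Fin 2) (Fin 2) K} (h1 : 1 ∈ W)
    (hy : y ∈ W) (hns : ∀ c : K, y ≠ c • 1)
    (hW : ∀ s : SL(2, K), ∀ m ∈ W, (s : Matrix (Fin 2) (Fin 2) K) * m * (s⁻¹ : SL(2, K)) ∈ W) :
    W = ⊤ := by
  let E : Matrix (Fin 2) (Fin 2) K := !![0, 1; 0, 0]
  let F : Matrix (Fin 2) (Fin 2) K := !![0, 0; 1, 0]
  let u : SL(2, K) := ⟨!![1, 1; 0, 1], by simp [Matrix.det_fin_two]⟩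
  let l : SL(2, K) := ⟨!![1, 0; 1, 1], by simp [Matrix.det_fin_two]⟩
  have hu : ∀ m : Matrix (Fin 2) (Fin 2) K,
      (u : Matrix (Fin 2) (Fin 2) K) * m * (u⁻¹ : SL(2, K)) =
        !![m 0 0 + m 1 0, m 0 1 + m 1 1 - m 0 0 - m 1 0; m 1 0, m 1 1 - m 1 0] := by
    intro m
    rw [Matrix.SpecialLinearGroup.coe_inv, Matrix.adjugate_fin_two]
    ext i j; fin_cases i <;> fin_cases j <;>
      simp [u, Matrix.mul_apply, Matrix.vecMul, dotProduct, Fin.sum_univ_two] <;> ring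
  have hl : ∀ m : Matrix (Fin 2) (Fin 2) K,
      (l : Matrix (Fin 2) (Fin 2) K) * m * (l⁻¹ : SL(2, K)) =
        !![m 0 0 - m 0 1, m 0 1; m 1 0 + m 0 0 - m 1 1 - m 0 1, m 1 1 + m 0 1] := by
    intro m
    rw [Matrix.SpecialLinearGroup.coe_inv, Matrix.adjugate_fin_two]
    ext i j; fin_cases i <;> fin_cases j <;>
      simp [l, Matrix.mul_apply, Matrix.vecMul, dotProduct, Fin.sum_univ_two] <;> ring
  have hu' : ∀ m : Matrix (Fin 2) (Fin 2) K,
      ((u⁻¹ : SL(2, K)) : Matrix (Fin 2) (Fin 2) K) * m * (u⁻¹⁻¹ : SL(2, K)) =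
        !![m 0 0 - m 1 0, m 0 1 - m 1 1 + m 0 0 - m 1 0; m 1 0, m 1 1 + m 1 0] := by
    intro m
    rw [inv_inv, Matrix.SpecialLinearGroup.coe_inv, Matrix.adjugate_fin_two]
    ext i j; fin_cases i <;> fin_cases j <;>
      simp [u, Matrix.mul_apply, Matrix.vecMul, dotProduct, Fin.sum_univ_two] <;> ring
  have hl' : ∀ m : Matrix (Fin 2) (Fin 2) K,
      ((l⁻¹ : SL(2, K)) : Matrix (Fin 2) (Fin 2) K) * m * (l⁻¹⁻¹ : SL(2, K)) =
        !![m 0 0 + m 0 1, m 0 1; m 1 0 - m 0 0 + m 1 1 - m 0 1, m 1 1 - m 0 1] := by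
    intro m
    rw [inv_inv, Matrix.SpecialLinearGroup.coe_inv, Matrix.adjugate_fin_two]
    ext i j; fin_cases i <;> fin_cases j <;>
      simp [l, Matrix.mul_apply, Matrix.vecMul, dotProduct, Fin.sum_univ_two] <;> ring
  -- `u * m * u⁻¹ + u⁻¹ * m * u - 2 • m = -(2 * m 1 0) • E`, and likewise for `l` and `F`.
  have hE : ∀ m ∈ W, m 1 0 ≠ 0 → E ∈ W := by
    intro m hm h0
    have h := W.sub_mem (W.add_mem (hW u m hm) (hW u⁻¹ m hm)) (W.smul_mem 2 hm)
    refine (W.smul_mem_iff (neg_ne_zero.2 (mul_ne_zero h2 h0))).1 ?_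
    rw [hu, hu'] at h
    convert h using 1
    ext i j; fin_cases i <;> fin_cases j <;> simp [E] <;> ring
  have hF : ∀ m ∈ W, m 0 1 ≠ 0 → F ∈ W := by
    intro m hm h0
    have h := W.sub_mem (W.add_mem (hW l m hm) (hW l⁻¹ m hm)) (W.smul_mem 2 hm)
    refine (W.smul_mem_iff (neg_ne_zero.2 (mul_ne_zero h2 h0))).1 ?_
    rw [hl, hl'] at h
    convert h using 1
    ext i j; fin_cases i <;> fin_cases j <;> simp [F] <;> ring
  have hEF : E ∈ W → F ∈ W := fun h ↦ hF E h (by simp [E])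
  have hEW : E ∈ W := by
    by_cases h10 : y 1 0 = 0
    · by_cases h01 : y 0 1 = 0
      · have hd : y 1 1 - y 0 0 ≠ 0 := by
          intro h
          apply hns (y 0 0)
          ext i j; fin_cases i <;> fin_cases j <;> simp [h10, h01]
          linear_combination h
        have h := W.smul_mem (y 1 1 - y 0 0)⁻¹ (W.sub_mem (hW u y hy) hy)
        rw [hu] at h
        convert h using 1
        ext i j; fin_cases i <;> fin_cases j <;> simp [E, h10]
        field_simp; ring
      · exact hE F (hF y hy h01) (by simp [F])
    · exact hE y hy h10
  have hFW := hEF hEW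
  have hH : !![(1 : K), 0; 0, -1] ∈ W := by
    have h := W.sub_mem (W.sub_mem hEW (hW l E hEW)) hFW
    rw [hl] at h
    convert h using 1
    ext i j; fin_cases i <;> fin_cases j <;> simp [E, F]
  rw [eq_top_iff]
  intro m _
  have h := W.add_mem (W.add_mem (W.smul_mem (m 0 1) hEW) (W.smul_mem (m 1 0) hFW))
    (W.add_mem (W.smul_mem ((m 0 0 + m 1 1) / 2) h1) (W.smul_mem ((m 0 0 - m 1 1) / 2) hH))
  convert h using 1
  ext i j; fin_cases i <;> fin_cases j <;> simp [E, F] <;> field_simp <;> ring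

/-- The span of the identity and the conjugates `p * y * p⁻¹` with `p ∈ S ^ n`. -/
def conjSpan {K : Type*} [Field K] (S : Set SL(2, K)) (y : Matrix (Fin 2) (Fin 2) K) (n : ℕ) :
    Submodule K (Matrix (Fin 2) (Fin 2) K) :=
  Submodule.span K (insert 1
    ((fun p : SL(2, K) ↦ (p : Matrix (Fin 2) (Fin 2) K) * y * (p⁻¹ : SL(2, K))) '' (S ^ n)))

theorem conjSpan_mono {K : Type*} [Field K] {S : Set SL(2, K)} (h1 : 1 ∈ S)
    (y : Matrix (Fin 2) (Fin 2) K) : Monotone (conjSpan S y) := fun _ _ h ↦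
  Submodule.span_mono (Set.insert_subset_insert (Set.image_mono (Set.pow_right_monotone h1 h)))

theorem conj_mem_conjSpan_succ {K : Type*} [Field K] {S : Set SL(2, K)}
    {y : Matrix (Fin 2) (Fin 2) K} {n : ℕ} {s : SL(2, K)} (hs : s ∈ S)
    {m : Matrix (Fin 2) (Fin 2) K} (hm : m ∈ conjSpan S y n) :
    (s : Matrix (Fin 2) (Fin 2) K) * m * (s⁻¹ : SL(2, K)) ∈ conjSpan S y (n + 1) := by
  induction hm using Submodule.span_induction with
  | mem x hx =>
    rcases hx with rfl | ⟨p, hp, rfl⟩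
    · rw [mul_one, ← Matrix.SpecialLinearGroup.coe_mul, mul_inv_cancel]
      exact Submodule.subset_span (Set.mem_insert _ _)
    · refine Submodule.subset_span (Set.mem_insert_of_mem _ ⟨s * p, ?_, ?_⟩)
      · rw [pow_succ']; exact Set.mul_mem_mul hs hp
      · simp only [mul_inv_rev, Matrix.SpecialLinearGroup.coe_mul, mul_assoc]
  | zero => simp
  | add a b _ _ ha hb => rw [mul_add, add_mul]; exact add_mem ha hb
  | smul c a _ ha =>
    rw [Matrix.mul_smul, Matrix.smul_mul]; exact Submodule.smul_mem _ c ha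

theorem conjSpan_eq_top_of_eq_succ {K : Type*} [Field K] (h2 : (2 : K) ≠ 0) {S : Set SL(2, K)}
    (hS : Subgroup.closure S = ⊤) (hinv : S⁻¹ = S) (h1 : 1 ∈ S) {y : Matrix (Fin 2) (Fin 2) K}
    (hns : ∀ c : K, y ≠ c • 1) {n : ℕ} (hn : conjSpan S y n = conjSpan S y (n + 1)) :
    conjSpan S y n = ⊤ := by
  refine Submodule.eq_top_of_conj_mem (y := y) h2 (Submodule.subset_span (Set.mem_insert _ _))
    (Submodule.subset_span (Set.mem_insert_of_mem _ ⟨1, Set.one_mem_pow h1, by simp⟩)) hns ?_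
  intro s
  have hs : s ∈ Subgroup.closure S := by rw [hS]; trivial
  induction hs using Subgroup.closure_induction'' with
  | mem x hx => intro m hm; rw [hn]; exact conj_mem_conjSpan_succ hx hm
  | inv_mem x hx =>
    intro m hm; rw [hn]
    exact conj_mem_conjSpan_succ (by rw [← hinv]; exact Set.inv_mem_inv.2 hx) hm
  | one => intro m hm; simpa using hm
  | mul a b _ _ ha hb =>
    intro m hm
    have := ha _ (hb m hm)
    simpa only [mul_inv_rev, Matrix.SpecialLinearGroup.coe_mul, mul_assoc] using this

/-- Escape from subspaces: the spans `conjSpan S y n` grow in dimension until they stabilize, which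
happens only at the whole four-dimensional space. -/
theorem conjSpan_four_eq_top {K : Type*} [Field K] (h2 : (2 : K) ≠ 0) {S : Set SL(2, K)}
    (hS : Subgroup.closure S = ⊤) (hinv : S⁻¹ = S) (h1 : 1 ∈ S) {y : Matrix (Fin 2) (Fin 2) K}
    (hns : ∀ c : K, y ≠ c • 1) : conjSpan S y 4 = ⊤ := by
  have key : ∀ n, conjSpan S y n = ⊤ ∨ n ≤ Module.finrank K (conjSpan S y n) := by
    intro n
    induction n with
    | zero => exact Or.inr (Nat.zero_le _)
    | succ n ih =>
      have hle := conjSpan_mono h1 y (Nat.le_succ n)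
      rcases ih with h | h
      · left; rw [h] at hle; exact top_le_iff.1 hle
      · by_cases heq : conjSpan S y n = conjSpan S y (n + 1)
        · left; rw [← heq]; exact conjSpan_eq_top_of_eq_succ h2 hS hinv h1 hns heq
        · right
          exact lt_of_le_of_lt h (Submodule.finrank_lt_finrank_of_lt (lt_of_le_of_ne hle heq))
  rcases key 4 with h | h
  · exact h
  · apply Submodule.eq_top_of_finrank_eq
    have h4 : Module.finrank K (Matrix (Fin 2) (Fin 2) K) = 4 := by
      simp [Module.finrank_matrix]
    exact le_antisymm (Submodule.finrank_le _) (by rw [h4]; exact h)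

/-! ### The dimension estimate for trace classes -/

theorem Finset.card_le_two_mul_card_image {α β γ : Type*} [DecidableEq β] {s : Finset α}
    {f : α → β} {ι : α → γ} (hι : Function.Injective ι)
    (h : ∀ x ∈ s, ∃ c, ∀ y ∈ s, f x = f y → ι y = ι x ∨ ι y = c) : #s ≤ 2 * #(s.image f) := by
  classical
  refine Finset.card_le_mul_card_image s 2 fun b hb ↦ ?_
  obtain ⟨x, hx, rfl⟩ := Finset.mem_image.1 hb
  obtain ⟨c, hc⟩ := h x hx
  rw [← Finset.card_image_of_injective _ hι]
  refine (Finset.card_le_card (t := {ι x, c}) fun d hd ↦ ?_).trans Finset.card_le_two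
  obtain ⟨y, hy, rfl⟩ := Finset.mem_image.1 hd
  rw [Finset.mem_filter] at hy
  have := hc y hy.1 hy.2.symm
  simpa using this

section

variable {K : Type*} [Field K]

/-- On a set of matrices of trace `t`, the orbit map `x ↦ x * y * x⁻¹` is at most two-to-one,
unless some `x` and `x * y` are both traceless. -/
theorem card_le_two_mul_card_image_conj [DecidableEq SL(2, K)] {X : Finset SL(2, K)} {t : K}
    {y : SL(2, K)} (hX : ∀ x ∈ X, (x : Matrix (Fin 2) (Fin 2) K).trace = t)
    (hy : (y : Matrix (Fin 2) (Fin 2) K).trace ^ 2 ≠ 4)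
    (hne : ∀ x ∈ X, t ≠ 0 ∨ ((x : Matrix (Fin 2) (Fin 2) K) * y).trace ≠ 0) :
    #X ≤ 2 * #(X.image fun x ↦ x * y * x⁻¹) := by
  refine Finset.card_le_two_mul_card_image
    (ι := fun x : SL(2, K) ↦ (x : Matrix (Fin 2) (Fin 2) K)) Subtype.val_injective
    fun v hv ↦ ⟨_, fun w hw h ↦ Matrix.eq_or_eq_of_commute (y := y) (c := (v⁻¹ * w : SL(2, K)))
      (by rw [← Matrix.SpecialLinearGroup.coe_mul, mul_inv_cancel_left]) y.2 (v⁻¹ * w).2 ?_ hy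
      ((hX w hw).trans (hX v hv).symm) (by rw [hX v hv]; exact hne v hv)⟩
  have hcomm : (v⁻¹ * w) * y = y * (v⁻¹ * w) := by
    have h' : v * y * v⁻¹ = w * y * w⁻¹ := h
    calc (v⁻¹ * w) * y = v⁻¹ * (w * y * w⁻¹) * w := by group
      _ = v⁻¹ * (v * y * v⁻¹) * w := by rw [h']
      _ = y * (v⁻¹ * w) := by group
  rw [← Matrix.SpecialLinearGroup.coe_mul, hcomm, Matrix.SpecialLinearGroup.coe_mul]

/-- A set of matrices of fixed trace is controlled by the numbers of traces of its translates by two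
elements with invertible commutator. -/
theorem card_le_mul_card_image_trace {X : Finset SL(2, K)} [DecidableEq K] {t : K}
    (hX : ∀ x ∈ X, (x : Matrix (Fin 2) (Fin 2) K).trace = t) {a b : SL(2, K)}
    (hab : ((a : Matrix (Fin 2) (Fin 2) K) * b - b * a).det ≠ 0) :
    #X ≤ 2 * (#(X.image fun x ↦ ((x * a : SL(2, K)) : Matrix (Fin 2) (Fin 2) K).trace) *
      #(X.image fun x ↦ ((x * b : SL(2, K)) : Matrix (Fin 2) (Fin 2) K).trace)) := by
  have h1 : #X ≤ 2 * #(X.image fun x ↦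
      (((x * a : SL(2, K)) : Matrix (Fin 2) (Fin 2) K).trace,
        ((x * b : SL(2, K)) : Matrix (Fin 2) (Fin 2) K).trace)) := by
    refine Finset.card_le_two_mul_card_image
      (ι := fun x : SL(2, K) ↦ (x : Matrix (Fin 2) (Fin 2) K)) Subtype.val_injective
      fun x hx ↦ ⟨_, fun y hy h ↦ Matrix.eq_or_eq_of_trace_eq hab (x.2.trans y.2.symm)
        ((hX x hx).trans (hX y hy).symm) (Prod.ext_iff.1 h).1 (Prod.ext_iff.1 h).2⟩
  refine h1.trans (Nat.mul_le_mul_left 2 ?_)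
  rw [← Finset.card_product]
  refine Finset.card_le_card fun p hp ↦ ?_
  obtain ⟨x, hx, rfl⟩ := Finset.mem_image.1 hp
  exact Finset.mem_product.2 ⟨Finset.mem_image_of_mem _ hx, Finset.mem_image_of_mem _ hx⟩

theorem Matrix.SpecialLinearGroup.trace_conj (p y : SL(2, K)) :
    ((p * y * p⁻¹ : SL(2, K)) : Matrix (Fin 2) (Fin 2) K).trace =
      (y : Matrix (Fin 2) (Fin 2) K).trace := by
  rw [Matrix.SpecialLinearGroup.coe_mul, Matrix.trace_mul_comm,
    ← Matrix.SpecialLinearGroup.coe_mul, inv_mul_cancel_left]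

/-- In characteristic two, an element of trace zero has characteristic polynomial `(X + 1) ^ 2`,
hence it is not regular semisimple. -/
theorem IsRegularSemisimple.trace_ne_zero_or_two_ne_zero 
    {g : SL(2, K)} (hg : IsRegularSemisimple g) :
    (g : Matrix (Fin 2) (Fin 2) K).trace ≠ 0 ∨ (2 : K) ≠ 0 := by
  by_contra! hcon
  obtain ⟨htr, h2⟩ := hcon
  obtain ⟨α, β, hαβ, hα, hβ⟩ := hg
  have h2' : (2 : AlgebraicClosure K) = 0 := by
    rw [← map_ofNat (algebraMap K (AlgebraicClosure K)) 2, h2, map_zero]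
  have key : ∀ γ : AlgebraicClosure K, Module.End.HasEigenvalue (Matrix.toLin'
      ((g : Matrix (Fin 2) (Fin 2) K).map (algebraMap K (AlgebraicClosure K)))) γ →
      γ ^ 2 + 1 = 0 := by
    intro γ hγ
    have hd := congrArg (algebraMap K (AlgebraicClosure K)) g.2
    have ht := congrArg (algebraMap K (AlgebraicClosure K)) htr
    obtain ⟨v, hv⟩ := hγ.exists_hasEigenvector
    have hv' := hv.apply_eq_smul
    rw [Matrix.toLin'_apply, ← sub_eq_zero] at hv'
    have hz : (((g : Matrix (Fin 2) (Fin 2) K).map (algebraMap K (AlgebraicClosure K))) -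
        γ • 1) *ᵥ v = 0 := by
      rw [Matrix.sub_mulVec, Matrix.smul_mulVec, Matrix.one_mulVec]; exact hv'
    have hdet := Matrix.exists_mulVec_eq_zero_iff.1 ⟨v, hv.2, hz⟩
    rw [Matrix.det_fin_two] at hdet hd
    rw [Matrix.trace_fin_two] at ht
    simp at hdet hd ht
    linear_combination hdet - hd + γ * ht
  have h0 : (α - β) ^ 2 = 0 := by
    linear_combination key α hα + key β hβ - (α * β + 1) * h2'
  exact hαβ (sub_eq_zero.1 (pow_eq_zero_iff two_ne_zero |>.1 h0))

theorem Finset.conj_mem_pow {G : Type*} [Group G] [DecidableEq G] {S : Finset G}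
    (hinv : S⁻¹ = S) {p y : G} {m n : ℕ} (hp : p ∈ S ^ m) (hy : y ∈ S ^ n) :
    p * y * p⁻¹ ∈ S ^ (m + n + m) := by
  have : p⁻¹ ∈ S ^ m := by
    rw [← hinv, inv_pow]; exact Finset.inv_mem_inv hp
  rw [pow_add, pow_add]
  exact Finset.mul_mem_mul (Finset.mul_mem_mul hp hy) this

/-- If `X ⊆ S` lies in one trace class, then for every `y ∈ S ^ 3` of trace different from `± 2`
at least `#X / 8` elements of `S ^ 13` have the same trace as `y`, namely conjugates of `y`. When
`X` is traceless, the orbit map of `y` can fail to be finite-to-one, but then one of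
at most four conjugates of `y`, spanning the space of matrices together with `1`, can replace it for a
quarter of `X`. -/
theorem card_le_mul_card_trace_fiber [DecidableEq K] [DecidableEq SL(2, K)] {S : Finset SL(2, K)}
    (hS : Subgroup.closure (S : Set SL(2, K)) = ⊤) (hinv : S⁻¹ = S) (h1 : 1 ∈ S)
    {X : Finset SL(2, K)} (hXS : X ⊆ S) {t : K}
    (hX : ∀ x ∈ X, (x : Matrix (Fin 2) (Fin 2) K).trace = t) (ht : t ≠ 0 ∨ (2 : K) ≠ 0)
    {y : SL(2, K)} (hyS : y ∈ S ^ 3) (hy : (y : Matrix (Fin 2) (Fin 2) K).trace ^ 2 ≠ 4) :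
    #X ≤ 8 * #((S ^ 13).filter fun z : SL(2, K) ↦ (z : Matrix (Fin 2) (Fin 2) K).trace =
      (y : Matrix (Fin 2) (Fin 2) K).trace) := by
  have step : ∀ p ∈ S ^ 4, ∀ Z ⊆ X,
      (∀ x ∈ Z, t ≠ 0 ∨ ((x : Matrix (Fin 2) (Fin 2) K) * (p * y * p⁻¹ : SL(2, K))).trace ≠ 0) →
      #Z ≤ 2 * #((S ^ 13).filter fun z : SL(2, K) ↦ (z : Matrix (Fin 2) (Fin 2) K).trace =
        (y : Matrix (Fin 2) (Fin 2) K).trace) := by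
    intro p hp Z hZ hne
    refine (card_le_two_mul_card_image_conj (fun x hx ↦ hX x (hZ hx))
      (by rw [Matrix.SpecialLinearGroup.trace_conj]; exact hy) hne).trans
      (Nat.mul_le_mul_left 2 (Finset.card_le_card fun z hz ↦ ?_))
    obtain ⟨x, hx, rfl⟩ := Finset.mem_image.1 hz
    rw [Finset.mem_filter, Matrix.SpecialLinearGroup.trace_conj,
      Matrix.SpecialLinearGroup.trace_conj]
    refine ⟨?_, rfl⟩
    have hx1 : x ∈ S ^ 1 := by rw [pow_one]; exact hXS (hZ hx)
    have hm := Finset.conj_mem_pow hinv hx1 (Finset.conj_mem_pow hinv hp hyS)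
    rwa [show 1 + (4 + 3 + 4) + 1 = 13 from rfl] at hm
  by_cases ht0 : t = 0
  · have h2 : (2 : K) ≠ 0 := by tauto
    have hns : ∀ c : K, (y : Matrix (Fin 2) (Fin 2) K) ≠ c • 1 := by
      intro c hc
      have hd := y.2
      rw [hc] at hd hy
      rw [Matrix.det_fin_two] at hd
      rw [Matrix.trace_fin_two] at hy
      apply hy
      simp only [Matrix.smul_apply, Matrix.one_apply_eq, smul_eq_mul] at hd ⊢
      simp at hd
      linear_combination 4 * hd
    have htop := conjSpan_four_eq_top h2 hS (by rw [← Finset.coe_inv, hinv]) h1 hns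
    obtain ⟨B, hBsub, hBspan, hBli⟩ := exists_linearIndependent K (insert 1
      ((fun p : SL(2, K) ↦ (p : Matrix (Fin 2) (Fin 2) K) * y * (p⁻¹ : SL(2, K))) ''
        ((S : Set SL(2, K)) ^ 4)))
    have hBfin : B.Finite := hBli.setFinite
    have hBcard : #hBfin.toFinset ≤ 4 := by
      have := hBfin.fintype
      have h := hBli.fintype_card_le_finrank
      rw [Set.Finite.card_toFinset]
      simpa [Module.finrank_matrix] using h
    have hcover : X ⊆ hBfin.toFinset.biUnion fun b ↦
        X.filter fun x : SL(2, K) ↦ ((x : Matrix (Fin 2) (Fin 2) K) * b).trace ≠ 0 := by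
      intro x hx
      by_contra hcon
      simp only [Finset.mem_biUnion, Finset.mem_filter, Set.Finite.mem_toFinset, not_exists,
        not_and, not_not] at hcon
      -- Otherwise `m ↦ (x * m).trace` vanishes on a spanning set, but at `x⁻¹` it equals `2`.
      let L : Matrix (Fin 2) (Fin 2) K →ₗ[K] K :=
        Matrix.traceLinearMap (Fin 2) K K ∘ₗ LinearMap.mulLeft K (x : Matrix (Fin 2) (Fin 2) K)
      have hker : (⊤ : Submodule K (Matrix (Fin 2) (Fin 2) K)) ≤ LinearMap.ker L := by
        rw [← htop, conjSpan, ← hBspan, Submodule.span_le]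
        intro b hb
        exact hcon b hb hx
      have h := hker (show ((x⁻¹ : SL(2, K)) : Matrix (Fin 2) (Fin 2) K) ∈ _ from trivial)
      have h' : ((x : Matrix (Fin 2) (Fin 2) K) * (x⁻¹ : SL(2, K))).trace = 0 := h
      rw [← Matrix.SpecialLinearGroup.coe_mul, mul_inv_cancel, Matrix.SpecialLinearGroup.coe_one,
        Matrix.trace_one] at h'
      exact h2 (by simpa using h')
    have hpiece : ∀ b ∈ hBfin.toFinset,
        #(X.filter fun x : SL(2, K) ↦ ((x : Matrix (Fin 2) (Fin 2) K) * b).trace ≠ 0) ≤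
          2 * #((S ^ 13).filter fun z : SL(2, K) ↦ (z : Matrix (Fin 2) (Fin 2) K).trace =
            (y : Matrix (Fin 2) (Fin 2) K).trace) := by
      intro b hb
      rcases hBsub (hBfin.mem_toFinset.1 hb) with rfl | ⟨p, hp, rfl⟩
      · rw [Finset.filter_false_of_mem fun x hx ↦ by rw [mul_one, hX x hx, ht0]; simp]
        simp
      · refine step p (by exact_mod_cast hp) _ (Finset.filter_subset _ _) fun x hx ↦ Or.inr ?_
        exact (Finset.mem_filter.1 hx).2
    calc #X ≤ _ := Finset.card_le_card hcover
      _ ≤ _ := Finset.card_biUnion_le_card_mul _ _ _ hpiece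
      _ ≤ 4 * (2 * _) := Nat.mul_le_mul_right _ hBcard
      _ = _ := by ring
  · exact (step 1 (Finset.one_mem_pow h1) X subset_rfl fun x _ ↦ Or.inl ht0).trans
      (Nat.mul_le_mul_right _ (by norm_num))
/-- The dimension estimate for trace classes: if `X ⊆ S` consists of elements with the same trace as
a regular semisimple `g ∈ S`, then `#X` is at most a constant times `#(S ^ 13) ^ (2 / 3)`. -/
theorem card_pow_three_le_of_trace_eq [DecidableEq SL(2, K)] {S : Finset SL(2, K)}
    (hS : Subgroup.closure (S : Set SL(2, K)) = ⊤) (hinv : S⁻¹ = S) (h1 : 1 ∈ S)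
    {g : SL(2, K)} (hgS : g ∈ S) (hg : IsRegularSemisimple g)
    {X : Finset SL(2, K)} (hXS : X ⊆ S)
    (hX : ∀ x ∈ X, (x : Matrix (Fin 2) (Fin 2) K).trace =
      (g : Matrix (Fin 2) (Fin 2) K).trace) :
    #X ^ 3 ≤ 200 * #(S ^ 13) ^ 2 := by
  classical
  obtain ⟨b, hb, hgb⟩ := exists_det_commutator_ne_zero hS h1 hg
  have ht : (g : Matrix (Fin 2) (Fin 2) K).trace ≠ 0 ∨ (2 : K) ≠ 0 :=
    hg.trace_ne_zero_or_two_ne_zero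
  -- The trace classes of the elements `x * h` are disjoint and of size at least `#X / 8`.
  have hcount : ∀ h ∈ S ^ 2,
      #X * #(X.image fun x ↦ ((x * h : SL(2, K)) : Matrix (Fin 2) (Fin 2) K).trace) ≤
        10 * #(S ^ 13) := by
    intro h hh
    obtain ⟨T, hT⟩ : ∃ T, T = X.image fun x ↦
      ((x * h : SL(2, K)) : Matrix (Fin 2) (Fin 2) K).trace := ⟨_, rfl⟩
    rw [← hT]
    -- At most the two traces `2` and `-2` have to be discarded.
    have hbad : #T ≤ #{τ ∈ T | τ ^ 2 ≠ 4} + 2 := by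
      have hsub : T ⊆ {τ ∈ T | τ ^ 2 ≠ 4} ∪ {2, -2} := by
        intro τ hτ
        by_cases h4 : τ ^ 2 = 4
        · have : (τ - 2) * (τ + 2) = 0 := by linear_combination h4
          rcases mul_eq_zero.1 this with h0 | h0
          · simp [sub_eq_zero.1 h0]
          · simp [eq_neg_of_add_eq_zero_left h0]
        · simp [hτ, h4]
      exact (Finset.card_le_card hsub).trans ((Finset.card_union_le _ _).trans
        (Nat.add_le_add_left Finset.card_le_two _))
    have hgood : #X * #{τ ∈ T | τ ^ 2 ≠ 4} ≤ 8 * #(S ^ 13) := by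
      calc #X * #{τ ∈ T | τ ^ 2 ≠ 4} = ∑ _τ ∈ T with _τ ^ 2 ≠ 4, #X := by
            rw [Finset.sum_const, smul_eq_mul, mul_comm]
        _ ≤ ∑ τ ∈ T with τ ^ 2 ≠ 4,
            8 * #((S ^ 13).filter fun z : SL(2, K) ↦ (z : Matrix (Fin 2) (Fin 2) K).trace = τ) := by
            refine Finset.sum_le_sum fun τ hτ ↦ ?_
            rw [Finset.mem_filter, hT, Finset.mem_image] at hτ
            obtain ⟨⟨x, hx, rfl⟩, h4⟩ := hτ
            refine card_le_mul_card_trace_fiber hS hinv h1 hXS hX ht ?_ h4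
            rw [pow_succ']
            exact Finset.mul_mem_mul (hXS hx) hh
        _ ≤ 8 * #(S ^ 13) := by
            rw [← Finset.mul_sum]
            refine Nat.mul_le_mul_left 8 ?_
            rw [← Finset.card_biUnion fun a _ b _ hab ↦ Finset.disjoint_filter.2
              fun z _ hz hz' ↦ hab (hz.symm.trans hz')]
            exact Finset.card_le_card (Finset.biUnion_subset.2 fun _ _ ↦ Finset.filter_subset _ _)
    have hXle : #X ≤ #(S ^ 13) := Finset.card_le_card
      (hXS.trans (Finset.subset_pow h1 (by norm_num)))
    calc #X * #T ≤ #X * (#{τ ∈ T | τ ^ 2 ≠ 4} + 2) := Nat.mul_le_mul_left _ hbad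
      _ ≤ 10 * #(S ^ 13) := by rw [mul_add]; omega
  have hbS : b ∈ S ^ 2 := by rw [pow_two]; exact_mod_cast hb
  have hg2 : g ∈ S ^ 2 := Finset.subset_pow h1 (by norm_num) hgS
  calc #X ^ 3 = #X * #X * #X := by ring
    _ ≤ #X * #X * (2 * (#(X.image fun x ↦
          ((x * g : SL(2, K)) : Matrix (Fin 2) (Fin 2) K).trace) *
        #(X.image fun x ↦ ((x * b : SL(2, K)) : Matrix (Fin 2) (Fin 2) K).trace))) :=
        Nat.mul_le_mul_left _ (card_le_mul_card_image_trace hX hgb)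
    _ = 2 * ((#X * #(X.image fun x ↦
          ((x * g : SL(2, K)) : Matrix (Fin 2) (Fin 2) K).trace)) *
        (#X * #(X.image fun x ↦ ((x * b : SL(2, K)) : Matrix (Fin 2) (Fin 2) K).trace))) := by
        ring
    _ ≤ 2 * ((10 * #(S ^ 13)) * (10 * #(S ^ 13))) :=
        Nat.mul_le_mul_left _ (Nat.mul_le_mul (hcount g hg2) (hcount b hbS))
    _ = 200 * #(S ^ 13) ^ 2 := by ring

end

/-! ### Orbit-stabilizer and small tripling -/

section
variable {G : Type*} [Group G] [DecidableEq G]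

/-- Orbit-stabilizer for sets: elements of `A` with the same conjugate of `g` differ by an element
of `A⁻¹ * A` centralizing `g`. -/
theorem Finset.card_le_card_centralizer_mul_card_conj (A : Finset G) (g : G)
    [DecidablePred (· ∈ Subgroup.centralizer {g})] :
    #A ≤ #((A⁻¹ * A).filter (· ∈ Subgroup.centralizer {g})) * #(A.image fun a ↦ a * g * a⁻¹) := by
  refine Finset.card_le_mul_card_image A _ fun x hx ↦ ?_
  obtain ⟨b, hb, rfl⟩ := Finset.mem_image.1 hx
  refine Finset.card_le_card_of_injOn (fun a ↦ b⁻¹ * a) (fun a ha ↦ ?_)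
    (mul_right_injective b⁻¹).injOn
  obtain ⟨ha, hab⟩ := Finset.mem_filter.1 ha
  refine Finset.mem_filter.2 ⟨Finset.mul_mem_mul (Finset.inv_mem_inv hb) ha, ?_⟩
  rw [Subgroup.mem_centralizer_singleton_iff]
  calc b⁻¹ * a * g = b⁻¹ * (a * g * a⁻¹) * a := by group
    _ = b⁻¹ * (b * g * b⁻¹) * a := by rw [hab]
    _ = g * (b⁻¹ * a) := by group

/-- A form of `Finset.small_alternating_pow_of_small_tripling` for words `l` of any length, also
shorter than three; the word is padded by three more factors `A`. -/
theorem Finset.card_prod_signs_le_of_small_tripling {A : Finset G} {k : ℝ} (hA : A.Nonempty)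
    (h : (#(A ^ 3) : ℝ) ≤ k * #A) (l : List ℤ) (hl : ∀ e ∈ l, |e| = 1) :
    (#(l.map fun e ↦ A ^ e).prod : ℝ) ≤ k ^ (3 * (l.length + 1)) * #A := by
  have h3 : ∀ e ∈ l ++ [1, 1, 1], |e| = 1 := by
    intro e he
    rcases List.mem_append.1 he with h | h
    · exact hl e h
    · have : e = 1 := by simpa using h
      simp [this]
  have key := Finset.small_alternating_pow_of_small_tripling (m := (l ++ [1, 1, 1]).length)
    (by simp) h (fun i ↦ (l ++ [1, 1, 1]).get i) (fun i ↦ h3 _ (List.get_mem _ _))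
  have hmap : (List.finRange (l ++ [1, 1, 1]).length).map
      (fun i ↦ A ^ (l ++ [1, 1, 1]).get i) = (l ++ [1, 1, 1]).map fun e ↦ A ^ e := by
    conv_rhs => rw [← List.map_get_finRange (l ++ [1, 1, 1]), List.map_map]
    rfl
  rw [hmap, List.map_append, List.prod_append] at key
  have hne : (([1, 1, 1] : List ℤ).map fun e ↦ A ^ e).prod.Nonempty := by
    simpa using hA.mul (hA.mul hA)
  refine le_trans (by exact_mod_cast Finset.card_le_card_mul_right hne) (key.trans_eq ?_)
  congr 2
  simp

theorem Finset.card_pow_symmetrization_le_of_small_tripling {A : Finset G} {k : ℝ}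
    (hA : A.Nonempty) (hk : 1 ≤ k) (h : (#(A ^ 3) : ℝ) ≤ k * #A) (m : ℕ) :
    (#((A ∪ A⁻¹ ∪ {1}) ^ m) : ℝ) ≤ 3 ^ m * (k ^ (3 * (m + 1)) * #A) := by
  -- Expand `(A ∪ A⁻¹ ∪ {1}) ^ m` one factor at a time into words `l` in `A` and `A⁻¹`.
  have key : ∀ m : ℕ, ∀ l : List ℤ, (∀ e ∈ l, |e| = 1) →
      (#((A ∪ A⁻¹ ∪ {1}) ^ m * (l.map fun e ↦ A ^ e).prod) : ℝ) ≤
        3 ^ m * (k ^ (3 * (m + l.length + 1)) * #A) := by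
    intro m
    induction m with
    | zero =>
      intro l hl
      simpa using Finset.card_prod_signs_le_of_small_tripling hA h l hl
    | succ m ih =>
      intro l hl
      have i1 := ih (1 :: l) (by simpa using hl)
      have i2 := ih (-1 :: l) (by simpa using hl)
      have i3 := ih l hl
      have hmono : k ^ (3 * (m + l.length + 1)) ≤ k ^ (3 * (m + 1 + l.length + 1)) :=
        pow_le_pow_right₀ hk (by omega)
      have e1 : m + (l.length + 1) + 1 = m + 1 + l.length + 1 := by omega
      simp only [List.map_cons, List.prod_cons, zpow_one, zpow_neg, List.length_cons, e1]
        at i1 i2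
      have hcard : #((A ∪ A⁻¹ ∪ {1}) ^ (m + 1) * (l.map fun e ↦ A ^ e).prod) ≤
          #((A ∪ A⁻¹ ∪ {1}) ^ m * (A * (l.map fun e ↦ A ^ e).prod)) +
          #((A ∪ A⁻¹ ∪ {1}) ^ m * (A⁻¹ * (l.map fun e ↦ A ^ e).prod)) +
          #((A ∪ A⁻¹ ∪ {1}) ^ m * (l.map fun e ↦ A ^ e).prod) := by
        rw [pow_succ, mul_assoc, Finset.union_mul, Finset.union_mul, Finset.mul_union,
          Finset.mul_union, Finset.singleton_one, one_mul]
        exact (Finset.card_union_le _ _).trans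
          (Nat.add_le_add_right (Finset.card_union_le _ _) _)
      have hA0 : (0 : ℝ) ≤ #A := Nat.cast_nonneg _
      calc (#((A ∪ A⁻¹ ∪ {1}) ^ (m + 1) * (l.map fun e ↦ A ^ e).prod) : ℝ)
          ≤ 3 ^ m * (k ^ (3 * (m + 1 + l.length + 1)) * #A) +
            3 ^ m * (k ^ (3 * (m + 1 + l.length + 1)) * #A) +
            3 ^ m * (k ^ (3 * (m + 1 + l.length + 1)) * #A) := by
            refine le_trans (by exact_mod_cast hcard) (add_le_add (add_le_add i1 i2) (i3.trans ?_))
            gcongr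
        _ = 3 ^ (m + 1) * (k ^ (3 * (m + 1 + l.length + 1)) * #A) := by ring
  simpa using key m [] (by simp)

end

/-! ### Centralizers of regular semisimple elements -/

/-- The orbit-stabilizer bound combined with the dimension estimate, applied to
`S = (A ∪ A⁻¹ ∪ {1}) ^ (ℓ + 2)`, which contains `g` and its conjugates by `A`. The exponent is
`13 * (ℓ + 2) ≤ 39 * ℓ`. -/
theorem card_le_card_centralizer_mul_rpow {K : Type*} [Field K] [DecidableEq SL(2, K)]
    {A : Finset SL(2, K)} (hA : Subgroup.closure (A : Set SL(2, K)) = ⊤) {ℓ : ℕ} (hℓ : 1 ≤ ℓ)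
    {g : SL(2, K)} (hgA : g ∈ A ^ ℓ) (hg : IsRegularSemisimple g)
    [DecidablePred (· ∈ Subgroup.centralizer {g})] :
    (#A : ℝ) ≤ #((A⁻¹ * A).filter (· ∈ Subgroup.centralizer {g})) *
      (6 * (#((A ∪ A⁻¹ ∪ {1}) ^ (39 * ℓ)) : ℝ) ^ (2 / 3 : ℝ)) := by
  obtain ⟨B, hB⟩ : ∃ B, B = A ∪ A⁻¹ ∪ {1} := ⟨_, rfl⟩
  have hAB : A ⊆ B := by
    rw [hB]; exact Finset.subset_union_left.trans Finset.subset_union_left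
  have h1B : (1 : SL(2, K)) ∈ B := by rw [hB]; simp
  have hBinv : B⁻¹ = B := by
    rw [hB]; ext x; simp [or_comm]
  have hBS : B ⊆ B ^ (ℓ + 2) := Finset.subset_pow h1B (by omega)
  have hXS : (A.image fun a ↦ a * g * a⁻¹) ⊆ B ^ (ℓ + 2) := by
    intro x hx
    obtain ⟨a, ha, rfl⟩ := Finset.mem_image.1 hx
    have hm := Finset.conj_mem_pow hBinv (m := 1) (by rw [pow_one]; exact hAB ha)
      (Finset.pow_subset_pow_left hAB hgA)
    rwa [show 1 + ℓ + 1 = ℓ + 2 by ring] at hm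
  have hS : Subgroup.closure ((B ^ (ℓ + 2) : Finset SL(2, K)) : Set SL(2, K)) = ⊤ := by
    rw [eq_top_iff, ← hA]
    exact Subgroup.closure_mono (Finset.coe_subset.2 (hAB.trans hBS))
  have hcube := card_pow_three_le_of_trace_eq hS (by rw [← inv_pow, hBinv])
    (Finset.one_mem_pow h1B) (Finset.pow_subset_pow_right h1B (by omega : ℓ ≤ ℓ + 2)
      (Finset.pow_subset_pow_left hAB hgA)) hg hXS (by
      intro x hx
      obtain ⟨a, ha, rfl⟩ := Finset.mem_image.1 hx
      exact Matrix.SpecialLinearGroup.trace_conj a g)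
  have hpow : #((B ^ (ℓ + 2)) ^ 13) ≤ #(B ^ (39 * ℓ)) := by
    rw [← pow_mul]
    exact Finset.card_le_card (Finset.pow_subset_pow_right h1B (by omega))
  rw [← hB]
  have hX : (#(A.image fun a ↦ a * g * a⁻¹) : ℝ) ≤
      6 * (#(B ^ (39 * ℓ)) : ℝ) ^ (2 / 3 : ℝ) := by
    refine le_of_pow_le_pow_left₀ (n := 3) (by norm_num) (by positivity) ?_
    have h2 : ((#(B ^ (39 * ℓ)) : ℝ) ^ (2 / 3 : ℝ)) ^ 3 = (#(B ^ (39 * ℓ)) : ℝ) ^ 2 := by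
      rw [← Real.rpow_natCast, ← Real.rpow_mul (Nat.cast_nonneg _), ← Real.rpow_natCast]
      norm_num
    rw [mul_pow, h2]
    have h3 : (#(A.image fun a ↦ a * g * a⁻¹) : ℝ) ^ 3 ≤ 200 * (#(B ^ (39 * ℓ)) : ℝ) ^ 2 := by
      exact_mod_cast hcube.trans (Nat.mul_le_mul_left _ (Nat.pow_le_pow_left hpow 2))
    nlinarith [sq_nonneg (#(B ^ (39 * ℓ)) : ℝ)]
  calc (#A : ℝ) ≤ #((A⁻¹ * A).filter (· ∈ Subgroup.centralizer {g})) *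
        #(A.image fun a ↦ a * g * a⁻¹) := by
        exact_mod_cast Finset.card_le_card_centralizer_mul_card_conj A g
    _ ≤ _ := mul_le_mul_of_nonneg_left hX (Nat.cast_nonneg _)

theorem mainTheorem4 :
    (∃ k : ℕ, ∃ c : ℝ, 0 < c ∧
      ∀ (K : Type u) [Field K] (A : Set (Matrix.SpecialLinearGroup (Fin 2) K)),
        A.Finite → Subgroup.closure A = ⊤ →
        ∀ ℓ : ℕ, 1 ≤ ℓ → ∀ g ∈ A ^ ℓ, IsRegularSemisimple g →
          c * ((A.ncard : ℝ) / (((A ∪ A⁻¹ ∪ {1}) ^ (k * ℓ)).ncard : ℝ) ^ (2 / 3 : ℝ)) ≤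
            (((A⁻¹ * A) ∩ (Subgroup.centralizer {g} : Set _)).ncard : ℝ)) ∧
    (∃ C : ℝ, 0 < C ∧ ∀ ℓ : ℕ, 1 ≤ ℓ → ∃ c : ℝ, 0 < c ∧
      ∀ (K : Type u) [Field K] (A : Set (Matrix.SpecialLinearGroup (Fin 2) K)),
        A.Finite → Subgroup.closure A = ⊤ →
        ∀ g ∈ A ^ ℓ, IsRegularSemisimple g →
        ∀ δ : ℝ, ((A ^ 3).ncard : ℝ) ≤ (A.ncard : ℝ) ^ (1 + δ) →
          c * (A.ncard : ℝ) ^ (1 / 3 - C * (δ * ℓ)) ≤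
            (((A⁻¹ * A) ∩ (Subgroup.centralizer {g} : Set _)).ncard : ℝ)) := by
  classical
  have hcent : ∀ (K : Type u) [Field K] (A : Finset SL(2, K)) (g : SL(2, K)),
      (((A : Set SL(2, K))⁻¹ * A) ∩ (Subgroup.centralizer {g} : Set _)).ncard =
        #((A⁻¹ * A).filter (· ∈ Subgroup.centralizer {g})) := by
    intro K _ A g
    rw [← Set.ncard_coe_finset]
    congr 1
    rw [← Finset.coe_inv, ← Finset.coe_mul]
    ext x
    rw [Set.mem_inter_iff, Finset.mem_coe, Finset.mem_coe, Finset.mem_filter]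
    rfl
  refine ⟨⟨39, 1 / 6, by norm_num, ?_⟩, ⟨80, by norm_num, ?_⟩⟩
  · intro K _ A hfin hA ℓ hℓ g hgA hg
    lift A to Finset SL(2, K) using hfin
    have hgA' : g ∈ A ^ ℓ := by exact_mod_cast hgA
    have key := card_le_card_centralizer_mul_rpow hA hℓ hgA' hg
    have hpow : ((A : Set SL(2, K)) ∪ (A : Set SL(2, K))⁻¹ ∪ {1}) ^ (39 * ℓ) =
        (((A ∪ A⁻¹ ∪ {1}) ^ (39 * ℓ) : Finset SL(2, K)) : Set SL(2, K)) := by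
      push_cast; rfl
    rw [hcent, hpow, Set.ncard_coe_finset, Set.ncard_coe_finset]
    have hpos : 0 < (#((A ∪ A⁻¹ ∪ {1}) ^ (39 * ℓ)) : ℝ) := by
      have : (1 : SL(2, K)) ∈ (A ∪ A⁻¹ ∪ {1}) ^ (39 * ℓ) := Finset.one_mem_pow (by simp)
      exact_mod_cast Finset.card_pos.2 ⟨1, this⟩
    rw [← mul_div_assoc, div_le_iff₀ (Real.rpow_pos_of_pos hpos _)]
    linarith
  · intro ℓ hℓ
    refine ⟨1 / (6 * ((3 : ℝ) ^ (39 * ℓ)) ^ (2 / 3 : ℝ)), by positivity, ?_⟩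
    intro K _ A hfin hA g hgA hg δ hδ
    lift A to Finset SL(2, K) using hfin
    have hgA' : g ∈ A ^ ℓ := by exact_mod_cast hgA
    have hne : A.Nonempty := by
      rw [Finset.nonempty_iff_ne_empty]
      rintro rfl
      rw [Finset.empty_pow (by omega)] at hgA'
      exact Finset.notMem_empty _ hgA'
    have key := card_le_card_centralizer_mul_rpow hA hℓ hgA' hg
    rw [hcent, Set.ncard_coe_finset]
    rw [← Finset.coe_pow, Set.ncard_coe_finset, Set.ncard_coe_finset] at hδ
    obtain ⟨Z, hZ⟩ : ∃ Z : ℝ, Z = #((A⁻¹ * A).filter (· ∈ Subgroup.centralizer {g})) := ⟨_, rfl⟩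
    obtain ⟨a, ha⟩ : ∃ a : ℝ, a = #A := ⟨_, rfl⟩
    have ha0 : 0 < a := by rw [ha]; exact_mod_cast hne.card_pos
    have hZ0 : 0 ≤ Z := by rw [hZ]; exact Nat.cast_nonneg _
    have htrip : (#(A ^ 3) : ℝ) ≤ a ^ δ * #A := by
      rw [← ha] at hδ ⊢
      rwa [add_comm, Real.rpow_add ha0, Real.rpow_one] at hδ
    have hk : 1 ≤ a ^ δ := by
      have h13 : a ≤ #(A ^ 3) := by rw [ha]; exact_mod_cast Finset.card_le_card_pow (by norm_num)
      rw [← ha] at htrip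
      exact one_le_of_le_mul_right₀ ha0 (h13.trans htrip)
    have hgrow := Finset.card_pow_symmetrization_le_of_small_tripling hne hk htrip (39 * ℓ)
    have hM : (#((A ∪ A⁻¹ ∪ {1}) ^ (39 * ℓ)) : ℝ) ≤ 3 ^ (39 * ℓ) * a ^ (1 + 120 * (δ * ℓ)) := by
      refine hgrow.trans (mul_le_mul_of_nonneg_left ?_ (by positivity))
      rw [← ha]
      calc (a ^ δ) ^ (3 * (39 * ℓ + 1)) * a ≤ (a ^ δ) ^ (120 * ℓ) * a :=
            mul_le_mul_of_nonneg_right (pow_le_pow_right₀ hk (by omega)) ha0.le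
        _ = a ^ (1 + 120 * (δ * ℓ)) := by
            rw [← Real.rpow_natCast, ← Real.rpow_mul ha0.le, add_comm, Real.rpow_add ha0,
              Real.rpow_one]
            push_cast
            ring_nf
    have hM' : (#((A ∪ A⁻¹ ∪ {1}) ^ (39 * ℓ)) : ℝ) ^ (2 / 3 : ℝ) ≤
        ((3 : ℝ) ^ (39 * ℓ)) ^ (2 / 3 : ℝ) * a ^ (2 / 3 + 80 * (δ * ℓ)) := by
      refine (Real.rpow_le_rpow (Nat.cast_nonneg _) hM (by norm_num)).trans_eq ?_
      rw [Real.mul_rpow (by positivity) (by positivity), ← Real.rpow_mul ha0.le]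
      ring_nf
    rw [← hZ, ← ha] at key ⊢
    rw [one_div, ← div_eq_inv_mul, div_le_iff₀ (by positivity)]
    have hsplit : a = a ^ (1 / 3 - 80 * (δ * ℓ)) * a ^ (2 / 3 + 80 * (δ * ℓ)) := by
      rw [← Real.rpow_add ha0]
      ring_nf
      rw [Real.rpow_one]
    have hpos : 0 < a ^ (2 / 3 + 80 * (δ * ℓ)) := Real.rpow_pos_of_pos ha0 _
    refine le_of_mul_le_mul_right ?_ hpos
    calc a ^ (1 / 3 - 80 * (δ * ℓ)) * a ^ (2 / 3 + 80 * (δ * ℓ)) = a := hsplit.symm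
      _ ≤ Z * (6 * (#((A ∪ A⁻¹ ∪ {1}) ^ (39 * ℓ)) : ℝ) ^ (2 / 3 : ℝ)) := key
      _ ≤ Z * (6 * (((3 : ℝ) ^ (39 * ℓ)) ^ (2 / 3 : ℝ) * a ^ (2 / 3 + 80 * (δ * ℓ)))) := by
          gcongr
      _ = _ := by ring
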